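/- For a finite set $X\subset\mathbb{R}$ let $$\mathsf{E}^+(X)=|\{(a_1,a_2,b_1,b_2)\in X^4: a_1+b_1=a_2+b_2\}|,\qquad \mathsf{E}^\times(X)=|\{(a_1,a_2,b_1,b_2)\in X^4: a_1b_1=a_2b_2\}|$$ be its additive and multiplicative energy. There are absolute constants $K>0$ and $c>0$ such that for every finite set $A\subset\mathbb{R}$ with $|A|\ge 2$ there are two disjoint subsets $B$ and $C$ of $A$ with $A=B\sqcup C$ and $$\max\{\mathsf{E}^+(B),\mathsf{E}^\times(C)\}\le K\,|A|^{3-1/5}\,(\log|A|)^{c}.$$ -/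

import Mathlib

/-! Two facts carry the proof. Let `N` bound the size of a set of nonzero reals `A'`. Incidences:
some nonempty `B ⊆ A'` has `E⁺(B)² E^×(A')³ ≲ N⁶ |B|⁸` up to logarithms
(`exists_subset_addEnergy_le`). Take `P` the popular products of `A'`, `B` the elements dividing
many members of `P` inside `A'`, and `X` the popular sums of `B`. Each `x = a + b` in `X` and `y ∈
P` with `y / a ∈ A'` put the point `(y, x)` on the line of slope `(y / a)⁻¹` and intercept `b`. A
Szemerédi–Trotter bound for `P × X` (`incidence_bound_of_product`) limits such incidences. Gluing:
`E⁺(·)^(1/4)` is subadditive (`addEnergy_union_le`), so the property `E⁺(B)^(1/4) ≤ κ |B|` survives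
disjoint unions. A largest `B` with it must leave a complement of multiplicative energy at most `H`,
since otherwise the first fact would enlarge it. The choice `H = N^(14/5)` makes both energies `H`
up to logarithms. -/

/-! ### Szemerédi–Trotter for Cartesian products, by counting cells of a grid. -/

/-- A finite set exceeds its image under `f` by at most the number of ordered pairs of distinct
elements on which `f` agrees. -/
lemma card_le_card_image_add_card_collisions {α ι : Type*} [DecidableEq α] [DecidableEq ι]
    (S : Finset α) (f : α → ι) :
    S.card ≤ (S.image f).card + (S.offDiag.filter fun z => f z.1 = f z.2).card := by
  classical
  rcases S.eq_empty_or_nonempty with rfl | ⟨s₀, hs₀⟩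
  · simp
  have hrep : ∀ i, ∃ u, i ∈ S.image f → u ∈ S ∧ f u = i := by
    intro i
    by_cases h : i ∈ S.image f
    · obtain ⟨u, hu, h'⟩ := Finset.mem_image.1 h
      exact ⟨u, fun _ => ⟨hu, h'⟩⟩
    · exact ⟨s₀, fun h' => absurd h' h⟩
  choose g hg using hrep
  have h1 : S ⊆ (S.image f).image g ∪
      (S.offDiag.filter fun z => f z.1 = f z.2).image Prod.snd := by
    intro u hu
    have hfu := Finset.mem_image_of_mem f hu
    obtain ⟨hm, he⟩ := hg _ hfu
    by_cases h : g (f u) = u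
    · exact Finset.mem_union_left _ (Finset.mem_image.2 ⟨_, hfu, h⟩)
    · refine Finset.mem_union_right _ (Finset.mem_image.2 ⟨(g (f u), u), ?_, rfl⟩)
      simp [hm, hu, h, he]
  calc S.card ≤ _ := Finset.card_le_card h1
    _ ≤ _ := Finset.card_union_le _ _
    _ ≤ _ := add_le_add Finset.card_image_le Finset.card_image_le

/-- The number of elements of `P` below `x`. -/
noncomputable def belowCount (P : Finset ℝ) (x : ℝ) : ℕ := (P.filter (· < x)).card

lemma belowCount_mono (P : Finset ℝ) : Monotone (belowCount P) := fun _ _ h =>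
  Finset.card_le_card (Finset.monotone_filter_right _ fun _ _ hx => lt_of_lt_of_le hx h)

lemma belowCount_lt_card {P : Finset ℝ} {x : ℝ} (hx : x ∈ P) : belowCount P x < P.card :=
  Finset.card_lt_card ⟨Finset.filter_subset _ _, fun h => by simpa using h hx⟩

lemma belowCount_injOn (P : Finset ℝ) : Set.InjOn (belowCount P) P := by
  have key : ∀ x ∈ P, ∀ y, x < y → belowCount P x < belowCount P y := by
    intro x hx y h
    refine Finset.card_lt_card ⟨Finset.monotone_filter_right _ fun _ _ hz => lt_trans hz h, ?_⟩
    intro h'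
    have := h' (Finset.mem_filter.2 ⟨hx, h⟩)
    simp at this
  intro x hx y hy h
  rcases lt_trichotomy x y with h' | h' | h'
  · exact absurd h (key x hx y h').ne
  · exact h'
  · exact absurd h (key y hy x h').ne'

/-- A finite set of reals can be cut into `r` consecutive blocks of size at most `2|P|/r`. -/
lemma exists_monotone_blocks (P : Finset ℝ) {r : ℕ} (hr : 0 < r) (hrP : r ≤ P.card) :
    ∃ (φ : ℝ → ℕ) (m : ℕ), Monotone φ ∧ (∀ x ∈ P, φ x < r) ∧
      (∀ i, (P.filter fun x => φ x = i).card ≤ m) ∧ r * m ≤ 2 * P.card := by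
  -- The block of `x` is its rank divided by the block size; `r ≤ |P|` absorbs the rounding into the
  -- factor 2.
  refine ⟨fun x => belowCount P x / (P.card / r + 1), P.card / r + 1, ?_, ?_, ?_, ?_⟩
  · intro x y h
    exact Nat.div_le_div_right (belowCount_mono P h)
  · intro x hx
    rw [Nat.div_lt_iff_lt_mul (Nat.succ_pos _)]
    have := Nat.lt_mul_div_succ P.card hr
    exact lt_trans (belowCount_lt_card hx) this
  · intro i
    have : ((P.filter fun x => belowCount P x / (P.card / r + 1) = i).image (belowCount P)) ⊆
        Finset.Ico (i * (P.card / r + 1)) ((i + 1) * (P.card / r + 1)) := by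
      intro n hn
      obtain ⟨x, hx, rfl⟩ := Finset.mem_image.1 hn
      have := (Finset.mem_filter.1 hx).2
      rw [Finset.mem_Ico, ← Nat.le_div_iff_mul_le (Nat.succ_pos _),
        ← Nat.div_lt_iff_lt_mul (Nat.succ_pos _)]
      exact ⟨this.ge, by rw [this]; exact Nat.lt_succ_self i⟩
    have h2 := Finset.card_le_card this
    rw [Finset.card_image_of_injOn] at h2
    · refine h2.trans ?_
      rw [Nat.card_Ico, add_mul]; omega
    · exact (belowCount_injOn P).mono fun x hx => (Finset.mem_filter.1 hx).1
  · have := Nat.mul_div_le P.card r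
    nlinarith

/-- The points of `S` on the line `y = ℓ.1 * x + ℓ.2`. -/
noncomputable def pointsOn (S : Finset (ℝ × ℝ)) (ℓ : ℝ × ℝ) : Finset (ℝ × ℝ) :=
  S.filter fun u => u.2 = ℓ.1 * u.1 + ℓ.2

lemma mem_pointsOn {S : Finset (ℝ × ℝ)} {ℓ u : ℝ × ℝ} :
    u ∈ pointsOn S ℓ ↔ u ∈ S ∧ u.2 = ℓ.1 * u.1 + ℓ.2 := Finset.mem_filter

/-- A non-vertical line meets at most `2r` cells of an `r × r` grid of cells. -/
lemma card_image_cells_le (P X : Finset ℝ) {φ ψ : ℝ → ℕ} {r : ℕ} (hφ : Monotone φ)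
    (hψ : Monotone ψ) (hφr : ∀ x ∈ P, φ x < r) (hψr : ∀ x ∈ X, ψ x < r)
    (ℓ : ℝ × ℝ) :
    ((pointsOn (P ×ˢ X) ℓ).image fun u => (φ u.1, ψ u.2)).card ≤ 2 * r := by
  have hmem : ∀ u ∈ pointsOn (P ×ˢ X) ℓ, φ u.1 < r ∧ ψ u.2 < r ∧ u.2 = ℓ.1 * u.1 + ℓ.2 := by
    intro u hu
    obtain ⟨h, h'⟩ := mem_pointsOn.1 hu
    obtain ⟨h1, h2⟩ := Finset.mem_product.1 h
    exact ⟨hφr _ h1, hψr _ h2, h'⟩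
  rw [← Finset.card_range (2 * r)]
  rcases le_total 0 ℓ.1 with ha | ha
  -- Along a nondecreasing line the cells met form a chain, so the coordinate sum separates them.
  · refine Finset.card_le_card_of_injOn (fun c => c.1 + c.2) ?_ ?_
    · intro c hc
      obtain ⟨u, hu, rfl⟩ := Finset.mem_image.1 hc
      have := hmem u hu
      simp only [Finset.coe_range, Set.mem_Iio]
      omega
    · intro c hc d hd h
      obtain ⟨u, hu, rfl⟩ := Finset.mem_image.1 hc
      obtain ⟨v, hv, rfl⟩ := Finset.mem_image.1 hd
      obtain ⟨-, -, eu⟩ := hmem u hu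
      obtain ⟨-, -, ev⟩ := hmem v hv
      simp only at h
      rcases le_total u.1 v.1 with huv | huv
      · have h1 := hφ huv
        have h2 : ψ u.2 ≤ ψ v.2 := hψ (by rw [eu, ev]; gcongr)
        ext <;> simp only <;> omega
      · have h1 := hφ huv
        have h2 : ψ v.2 ≤ ψ u.2 := hψ (by rw [eu, ev]; gcongr)
        ext <;> simp only <;> omega
  -- For a nonincreasing line the second index is reflected; `ψ < r` keeps the subtraction from
  -- truncating.
  · refine Finset.card_le_card_of_injOn (fun c => c.1 + (r - c.2)) ?_ ?_
    · intro c hc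
      obtain ⟨u, hu, rfl⟩ := Finset.mem_image.1 hc
      have := hmem u hu
      simp only [Finset.coe_range, Set.mem_Iio]
      omega
    · intro c hc d hd h
      obtain ⟨u, hu, rfl⟩ := Finset.mem_image.1 hc
      obtain ⟨v, hv, rfl⟩ := Finset.mem_image.1 hd
      obtain ⟨-, hu2, eu⟩ := hmem u hu
      obtain ⟨-, hv2, ev⟩ := hmem v hv
      simp only at h
      rcases le_total u.1 v.1 with huv | huv
      · have h1 := hφ huv
        have h2 : ψ v.2 ≤ ψ u.2 := hψ (by
          rw [eu, ev]
          have := mul_le_mul_of_nonpos_left huv ha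
          linarith)
        ext <;> simp only <;> omega
      · have h1 := hφ huv
        have h2 : ψ u.2 ≤ ψ v.2 := hψ (by
          rw [eu, ev]
          have := mul_le_mul_of_nonpos_left huv ha
          linarith)
        ext <;> simp only <;> omega

/-- Two distinct points lie on at most one common non-vertical line, so the pairs of distinct points
on lines of `Λ` satisfying a relation are at most the pairs of points satisfying it. -/
lemma sum_card_collisions_le {ι : Type*} [DecidableEq ι] (S Λ : Finset (ℝ × ℝ)) (f : ℝ × ℝ → ι) :
    ∑ ℓ ∈ Λ, ((pointsOn S ℓ).offDiag.filter fun z => f z.1 = f z.2).card ≤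
      ((S ×ˢ S).filter fun z => f z.1 = f z.2).card := by
  rw [← Finset.card_biUnion]
  · refine Finset.card_le_card ?_
    intro z hz
    obtain ⟨ℓ, -, hz⟩ := Finset.mem_biUnion.1 hz
    simp only [Finset.mem_filter, Finset.mem_offDiag, mem_pointsOn, Finset.mem_product] at hz ⊢
    tauto
  · intro ℓ _ ℓ' _ hne
    refine Finset.disjoint_left.2 fun z hz hz' => hne ?_
    simp only [Finset.mem_filter, Finset.mem_offDiag, mem_pointsOn] at hz hz'
    obtain ⟨⟨⟨-, h1⟩, ⟨-, h2⟩, h3⟩, -⟩ := hz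
    obtain ⟨⟨⟨-, h1'⟩, ⟨-, h2'⟩, -⟩, -⟩ := hz'
    have hx : z.1.1 - z.2.1 ≠ 0 := by
      intro h
      have h : z.1.1 = z.2.1 := sub_eq_zero.1 h
      exact h3 (Prod.ext h (by rw [h1, h2, h]))
    have e : ℓ.1 = ℓ'.1 := by
      apply mul_right_cancel₀ hx
      linear_combination h1' - h1 - h2' + h2
    refine Prod.ext e ?_
    rw [e] at h1
    linarith

/-- On each line, the incidences exceed the at most `2r` cells met by at most the pairs of points
sharing a cell. Over all lines these pairs are distinct, and small cells make them few. -/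
lemma sum_card_pointsOn_le (P X : Finset ℝ) (Λ : Finset (ℝ × ℝ)) {r : ℕ} (hr : 0 < r)
    (hrP : r ≤ P.card) (hrX : r ≤ X.card) :
    r ^ 2 * ∑ ℓ ∈ Λ, (pointsOn (P ×ˢ X) ℓ).card ≤
      2 * r ^ 3 * Λ.card + 4 * (P.card * X.card) ^ 2 := by
  obtain ⟨φ, m, hφ, hφr, hφm, hm⟩ := exists_monotone_blocks P hr hrP
  obtain ⟨ψ, n, hψ, hψr, hψn, hn⟩ := exists_monotone_blocks X hr hrX
  have hpairs : (((P ×ˢ X) ×ˢ (P ×ˢ X)).filter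
      fun z => (φ z.1.1, ψ z.1.2) = (φ z.2.1, ψ z.2.2)).card ≤ P.card * X.card * (m * n) := by
    rw [Finset.card_filter, Finset.sum_product, ← Finset.card_product, ← smul_eq_mul]
    refine Finset.sum_le_card_nsmul _ _ _ fun u _ => ?_
    rw [← Finset.card_filter]
    calc _ ≤ ((P.filter fun x => φ x = φ u.1) ×ˢ (X.filter fun x => ψ x = ψ u.2)).card := by
          refine Finset.card_le_card fun v hv => ?_
          simp only [Finset.mem_filter, Finset.mem_product, Prod.mk.injEq] at hv ⊢
          obtain ⟨⟨h1, h2⟩, h3, h4⟩ := hv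
          exact ⟨⟨h1, h3.symm⟩, h2, h4.symm⟩
      _ ≤ m * n := by
          rw [Finset.card_product]
          exact Nat.mul_le_mul (hφm _) (hψn _)
  have hI : ∑ ℓ ∈ Λ, (pointsOn (P ×ˢ X) ℓ).card ≤
      Λ.card * (2 * r) + P.card * X.card * (m * n) := by
    calc _ ≤ ∑ ℓ ∈ Λ, (2 * r + ((pointsOn (P ×ˢ X) ℓ).offDiag.filter
            fun z => (φ z.1.1, ψ z.1.2) = (φ z.2.1, ψ z.2.2)).card) := by
          refine Finset.sum_le_sum fun ℓ _ => ?_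
          refine (card_le_card_image_add_card_collisions _
            fun u : ℝ × ℝ => (φ u.1, ψ u.2)).trans ?_
          exact Nat.add_le_add_right (card_image_cells_le P X hφ hψ hφr hψr ℓ) _
      _ ≤ _ := by
          rw [Finset.sum_add_distrib, Finset.sum_const, smul_eq_mul]
          exact Nat.add_le_add_left ((sum_card_collisions_le (P ×ˢ X) Λ
            fun u : ℝ × ℝ => (φ u.1, ψ u.2)).trans hpairs) _
  have hmn := Nat.mul_le_mul hm hn
  calc _ ≤ r ^ 2 * (Λ.card * (2 * r) + P.card * X.card * (m * n)) := Nat.mul_le_mul_left _ hI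
    _ = 2 * r ^ 3 * Λ.card + P.card * X.card * (r * m * (r * n)) := by ring
    _ ≤ 2 * r ^ 3 * Λ.card + P.card * X.card * (2 * P.card * (2 * X.card)) := by gcongr
    _ = _ := by ring

lemma card_pointsOn_le_left (P X : Finset ℝ) (ℓ : ℝ × ℝ) :
    (pointsOn (P ×ˢ X) ℓ).card ≤ P.card := by
  refine Finset.card_le_card_of_injOn Prod.fst ?_ ?_
  · intro u hu
    exact (Finset.mem_product.1 (mem_pointsOn.1 hu).1).1
  · intro u hu v hv h
    refine Prod.ext h ?_
    rw [(mem_pointsOn.1 hu).2, (mem_pointsOn.1 hv).2, h]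

lemma card_pointsOn_le_right (P X : Finset ℝ) {ℓ : ℝ × ℝ} (hℓ : ℓ.1 ≠ 0) :
    (pointsOn (P ×ˢ X) ℓ).card ≤ X.card := by
  refine Finset.card_le_card_of_injOn Prod.snd ?_ ?_
  · intro u hu
    exact (Finset.mem_product.1 (mem_pointsOn.1 hu).1).2
  · intro u hu v hv h
    refine Prod.ext (mul_left_cancel₀ hℓ ?_) h
    have h1 := (mem_pointsOn.1 hu).2
    have h2 := (mem_pointsOn.1 hv).2
    rw [h] at h1
    linarith

/-- The Szemerédi–Trotter bound for a Cartesian product point set. -/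
theorem incidence_bound_of_product (P X : Finset ℝ) (Λ : Finset (ℝ × ℝ))
    (hΛ : ∀ ℓ ∈ Λ, ℓ.1 ≠ 0) :
    (∑ ℓ ∈ Λ, (pointsOn (P ×ˢ X) ℓ).card) ^ 3 ≤ 34 ^ 3 * (P.card * X.card * Λ.card) ^ 2 ∨
      ∑ ℓ ∈ Λ, (pointsOn (P ×ˢ X) ℓ).card ≤ 34 * Λ.card := by
  set I := ∑ ℓ ∈ Λ, (pointsOn (P ×ˢ X) ℓ).card with hI
  have hIP : I ≤ Λ.card * P.card :=
    Finset.sum_le_card_nsmul _ _ _ fun ℓ _ => card_pointsOn_le_left P X ℓ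
  have hIX : I ≤ Λ.card * X.card :=
    Finset.sum_le_card_nsmul _ _ _ fun ℓ hℓ => card_pointsOn_le_right P X (hΛ ℓ hℓ)
  rcases Nat.eq_zero_or_pos Λ.card with h0 | hΛ0
  · right; rw [h0] at hIP ⊢; simpa using hIP
  rcases Nat.eq_zero_or_pos P.card with h0 | hP0
  · right; rw [h0] at hIP; simp at hIP; simp [hIP]
  rcases Nat.eq_zero_or_pos X.card with h0 | hX0
  · right; rw [h0] at hIX; simp at hIX; simp [hIX]
  by_cases hbig : (P.card * X.card) ^ 2 < Λ.card
  · right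
    have := sum_card_pointsOn_le P X Λ one_pos hP0 hX0
    rw [← hI] at this
    omega
  left
  push Not at hbig
  set p := P.card
  set x := X.card
  set l := Λ.card
  -- `r` is the integer cube root of `(p * x) ^ 2 / l`, which balances the two terms of the cell
  -- bound. If `r` exceeds `p` or `x`, the trivial bound on incidences already suffices.
  obtain ⟨r, hr1, hr2⟩ : ∃ r, r ^ 3 * l ≤ (p * x) ^ 2 ∧ (p * x) ^ 2 < (r + 1) ^ 3 * l := by
    have hex : ∃ n, (p * x) ^ 2 < (n + 1) ^ 3 * l := by
      refine ⟨(p * x) ^ 2, ?_⟩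
      have : ((p * x) ^ 2 + 1) ≤ ((p * x) ^ 2 + 1) ^ 3 := Nat.le_self_pow (by norm_num) _
      nlinarith
    refine ⟨Nat.find hex, ?_, Nat.find_spec hex⟩
    rcases h : Nat.find hex with _ | n
    · simp
    · have := Nat.find_min hex (m := n) (by omega)
      push Not at this
      exact this
  have hr : 0 < r := by
    rcases Nat.eq_zero_or_pos r with h | h
    · rw [h] at hr2; simp at hr2; omega
    · exact h
  by_cases hrp : p < r
  · have h1 : p ^ 3 * l ≤ (p * x) ^ 2 := le_trans (by gcongr) hr1
    calc I ^ 3 ≤ (l * p) ^ 3 := by gcongr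
      _ = l ^ 2 * (p ^ 3 * l) := by ring
      _ ≤ l ^ 2 * (p * x) ^ 2 := by gcongr
      _ ≤ 34 ^ 3 * (p * x * l) ^ 2 := by nlinarith [Nat.zero_le ((p * x * l) ^ 2)]
  by_cases hrx : x < r
  · have h1 : x ^ 3 * l ≤ (p * x) ^ 2 := le_trans (by gcongr) hr1
    calc I ^ 3 ≤ (l * x) ^ 3 := by gcongr
      _ = l ^ 2 * (x ^ 3 * l) := by ring
      _ ≤ l ^ 2 * (p * x) ^ 2 := by gcongr
      _ ≤ 34 ^ 3 * (p * x * l) ^ 2 := by nlinarith [Nat.zero_le ((p * x * l) ^ 2)]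
  push Not at hrp hrx
  have hmain := sum_card_pointsOn_le P X Λ hr hrp hrx
  rw [← hI] at hmain
  have h8 : (r + 1) ^ 3 ≤ (2 * r) ^ 3 := by gcongr; omega
  have h9 : (p * x) ^ 2 ≤ 8 * r ^ 3 * l := by
    calc (p * x) ^ 2 ≤ (r + 1) ^ 3 * l := hr2.le
      _ ≤ (2 * r) ^ 3 * l := by gcongr
      _ = _ := by ring
  -- The constant is `34 = 2 + 4 * 8`, the 8 coming from `r + 1 ≤ 2 * r`.
  have h10 : I ≤ 34 * (r * l) := by
    refine Nat.le_of_mul_le_mul_left ?_ (pow_pos hr 2)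
    calc r ^ 2 * I ≤ 2 * r ^ 3 * l + 4 * (p * x) ^ 2 := hmain
      _ ≤ 2 * r ^ 3 * l + 4 * (8 * r ^ 3 * l) := by gcongr
      _ = r ^ 2 * (34 * (r * l)) := by ring
  calc I ^ 3 ≤ (34 * (r * l)) ^ 3 := by gcongr
    _ = 34 ^ 3 * l ^ 2 * (r ^ 3 * l) := by ring
    _ ≤ 34 ^ 3 * l ^ 2 * (p * x) ^ 2 := by gcongr
    _ = _ := by ring

/-! ### Dyadic pigeonholing and representation counts. -/

/-- Dyadic pigeonholing: a power sum of `f ≤ N` is, up to a logarithm, carried by one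
superlevel set. -/
lemma exists_dyadic_level {ι : Type*} (S : Finset ι) (f : ι → ℕ) {N : ℕ}
    (hf : ∀ s ∈ S, f s ≤ N) {k : ℕ} (hk : k ≠ 0) :
    ∃ t, 0 < t ∧ ∑ s ∈ S, f s ^ k ≤
      (Nat.log 2 N + 1) * ((2 * t) ^ k * (S.filter fun s => t ≤ f s).card) := by
  by_contra! hcon
  set L := Nat.log 2 N + 1
  have h1 : ∑ s ∈ S, f s ^ k ≤
      ∑ j ∈ Finset.range L, (2 * 2 ^ j) ^ k * (S.filter fun s => 2 ^ j ≤ f s).card := by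
    calc ∑ s ∈ S, f s ^ k ≤
        ∑ s ∈ S, ∑ j ∈ Finset.range L, if 2 ^ j ≤ f s then (2 * 2 ^ j) ^ k else 0 := by
          refine Finset.sum_le_sum fun s hs => ?_
          rcases Nat.eq_zero_or_pos (f s) with h | h
          · simp [h, hk]
          · have hmem : Nat.log 2 (f s) ∈ Finset.range L :=
              Finset.mem_range.2 (Nat.lt_succ_of_le (Nat.log_mono_right (hf s hs)))
            refine le_trans ?_ (Finset.single_le_sum (fun _ _ => Nat.zero_le _) hmem)
            rw [if_pos (Nat.pow_log_le_self 2 h.ne')]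
            have := Nat.lt_pow_succ_log_self one_lt_two (f s)
            rw [pow_succ'] at this
            exact Nat.pow_le_pow_left this.le k
      _ = _ := by
          rw [Finset.sum_comm]
          refine Finset.sum_congr rfl fun j _ => ?_
          rw [← Finset.sum_filter, Finset.sum_const, smul_eq_mul, mul_comm]
  have h2 : ∑ j ∈ Finset.range L, L * ((2 * 2 ^ j) ^ k * (S.filter fun s => 2 ^ j ≤ f s).card) <
      ∑ _j ∈ Finset.range L, ∑ s ∈ S, f s ^ k :=
    Finset.sum_lt_sum_of_nonempty ⟨0, by simp [L]⟩ fun j _ => hcon _ (by positivity)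
  rw [← Finset.mul_sum, Finset.sum_const, Finset.card_range, smul_eq_mul] at h2
  exact absurd h1 (not_le.2 (lt_of_mul_lt_mul_left h2 (Nat.zero_le _)))

section

open scoped Pointwise

/-- The number of representations of `x` as a sum `a + b` with `a ∈ A`, `b ∈ B`. -/
noncomputable def addRep (A B : Finset ℝ) (x : ℝ) : ℕ :=
  ((A ×ˢ B).filter fun u => u.1 + u.2 = x).card

/-- The number of representations of `x` as a product `a * b` with `a ∈ A`, `b ∈ B`. -/
noncomputable def mulRep (A B : Finset ℝ) (x : ℝ) : ℕ :=
  ((A ×ˢ B).filter fun u => u.1 * u.2 = x).card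

lemma addEnergy_eq_sum_addRep (A B : Finset ℝ) :
    A.addEnergy B = ∑ x ∈ A + B, addRep A B x ^ 2 := Finset.addEnergy_eq_sum_sq' A B

lemma mulEnergy_eq_sum_mulRep (A B : Finset ℝ) :
    A.mulEnergy B = ∑ x ∈ A * B, mulRep A B x ^ 2 := Finset.mulEnergy_eq_sum_sq' A B

lemma addRep_le_card (A B : Finset ℝ) (x : ℝ) : addRep A B x ≤ A.card := by
  refine Finset.card_le_card_of_injOn Prod.fst ?_ ?_
  · intro u hu
    exact (Finset.mem_product.1 (Finset.mem_filter.1 hu).1).1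
  · intro u hu v hv h
    have h1 := (Finset.mem_filter.1 hu).2
    have h2 := (Finset.mem_filter.1 hv).2
    refine Prod.ext h ?_
    rw [h] at h1
    linarith

lemma mulRep_le_card {A : Finset ℝ} (hA : 0 ∉ A) (B : Finset ℝ) (x : ℝ) :
    mulRep A B x ≤ A.card := by
  refine Finset.card_le_card_of_injOn Prod.fst ?_ ?_
  · intro u hu
    exact (Finset.mem_product.1 (Finset.mem_filter.1 hu).1).1
  · intro u hu v hv h
    have h1 := (Finset.mem_filter.1 hu).2
    have h2 := (Finset.mem_filter.1 hv).2
    have h0 : v.1 ≠ 0 := fun h' =>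
      hA (h' ▸ (Finset.mem_product.1 (Finset.mem_filter.1 hv).1).1)
    refine Prod.ext h (mul_left_cancel₀ h0 ?_)
    rw [h] at h1
    rw [h1, h2]

lemma sum_addRep_le (A B X : Finset ℝ) : ∑ x ∈ X, addRep A B x ≤ A.card * B.card := by
  unfold addRep
  rw [Finset.sum_card_fiberwise_eq_card_filter, ← Finset.card_product]
  exact Finset.card_filter_le _ _

lemma sum_mulRep_le (A B X : Finset ℝ) : ∑ x ∈ X, mulRep A B x ≤ A.card * B.card := by
  unfold mulRep
  rw [Finset.sum_card_fiberwise_eq_card_filter, ← Finset.card_product]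
  exact Finset.card_filter_le _ _

/-- The number of `x ∈ P` divisible by `a` inside `A`. -/
noncomputable def quotCount (A P : Finset ℝ) (a : ℝ) : ℕ := (P.filter fun x => x / a ∈ A).card

lemma quotCount_le_card (A P : Finset ℝ) {a : ℝ} (ha : a ≠ 0) : quotCount A P a ≤ A.card := by
  refine Finset.card_le_card_of_injOn (fun x => x / a) ?_ ?_
  · intro x hx
    exact (Finset.mem_filter.1 hx).2
  · intro x _ y _ h
    exact (div_left_inj' ha).1 h

/-- Both sides count pairs `(a, x)` with `a ∈ A`, `x ∈ P` and `x / a ∈ A`. -/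
lemma sum_quotCount {A : Finset ℝ} (hA : 0 ∉ A) (P : Finset ℝ) :
    ∑ a ∈ A, quotCount A P a = ∑ x ∈ P, mulRep A A x := by
  have h0 : ∀ a ∈ A, a ≠ 0 := fun a ha h => hA (h ▸ ha)
  have h1 : ∀ x, mulRep A A x = ∑ a ∈ A, if x / a ∈ A then 1 else 0 := by
    intro x
    rw [← Finset.card_filter]
    refine Finset.card_bij' (fun u _ => u.1) (fun a _ => (a, x / a)) ?_ ?_ ?_ ?_
    · intro u hu
      obtain ⟨h, h'⟩ := Finset.mem_filter.1 hu
      obtain ⟨h1, h2⟩ := Finset.mem_product.1 h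
      refine Finset.mem_filter.2 ⟨h1, ?_⟩
      rwa [← h', mul_div_cancel_left₀ _ (h0 _ h1)]
    · intro a ha
      obtain ⟨h, h'⟩ := Finset.mem_filter.1 ha
      refine Finset.mem_filter.2 ⟨Finset.mem_product.2 ⟨h, h'⟩, ?_⟩
      exact mul_div_cancel₀ _ (h0 _ h)
    · intro u hu
      obtain ⟨h, h'⟩ := Finset.mem_filter.1 hu
      obtain ⟨h1, h2⟩ := Finset.mem_product.1 h
      refine Prod.ext rfl ?_
      simp only
      rw [← h', mul_div_cancel_left₀ _ (h0 _ h1)]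
    · intro a _
      rfl
  simp_rw [h1]
  rw [Finset.sum_comm]
  refine Finset.sum_congr rfl fun a _ => ?_
  rw [← Finset.card_filter]
  rfl

/-! ### Large multiplicative energy yields a subset of small additive energy. -/

/-- If every element of `B` is a quotient of elements of `P` and `A` in `q` ways and every element
of `X` is a sum of elements of `B` in `τ` ways, then `P × X` has many incidences with the lines
`y = x / a + b`. -/
lemma card_mul_le_sum_pointsOn {A B P X : Finset ℝ} (hA : 0 ∉ A) {q τ : ℕ}
    (hq : ∀ a ∈ B, q ≤ quotCount A P a) (hτ : ∀ x ∈ X, τ ≤ addRep B B x) :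
    X.card * τ * q ≤
      ∑ ℓ ∈ (A ×ˢ B).image (fun u => (u.1⁻¹, u.2)), (pointsOn (P ×ˢ X) ℓ).card := by
  have h0 : ∀ a ∈ A, a ≠ 0 := fun a ha h => hA (h ▸ ha)
  calc X.card * τ * q
      ≤ ∑ x ∈ X, addRep B B x * q := by
        rw [← Finset.sum_mul]
        exact Nat.mul_le_mul_right _ (Finset.card_nsmul_le_sum _ _ _ hτ)
    _ ≤ ∑ x ∈ X, ∑ u ∈ (B ×ˢ B).filter (fun u => u.1 + u.2 = x), quotCount A P u.1 := by
        refine Finset.sum_le_sum fun x _ => Finset.card_nsmul_le_sum _ _ _ fun u hu => ?_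
        exact hq _ (Finset.mem_product.1 (Finset.mem_filter.1 hu).1).1
    _ = (X.sigma fun x => ((B ×ˢ B).filter fun u => u.1 + u.2 = x).sigma
          fun u => P.filter fun y => y / u.1 ∈ A).card := by
        simp only [Finset.card_sigma]
        rfl
    _ ≤ (((A ×ˢ B).image (fun u => (u.1⁻¹, u.2))).sigma fun ℓ => pointsOn (P ×ˢ X) ℓ).card := by
        -- The incidence retains `y`, `x` and `b`, and then `a = x - b` is recovered.
        refine Finset.card_le_card_of_injOn
          (fun z => ⟨((z.2.2 / z.2.1.1)⁻¹, z.2.1.2), (z.2.2, z.1)⟩) ?_ ?_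
        · rintro ⟨x, ⟨a, b⟩, y⟩ hz
          simp only [Finset.coe_sigma, Set.mem_sigma_iff, Finset.mem_coe, Finset.mem_filter,
            Finset.mem_product] at hz
          obtain ⟨hx, ⟨⟨ha, hb⟩, hab⟩, hy, hya⟩ := hz
          simp only [Finset.coe_sigma, Set.mem_sigma_iff, Finset.mem_coe, mem_pointsOn,
            Finset.mem_product]
          refine ⟨Finset.mem_image.2 ⟨(y / a, b), Finset.mem_product.2 ⟨hya, hb⟩, rfl⟩,
            ⟨hy, hx⟩, ?_⟩
          have hy0 : y ≠ 0 := fun h => h0 _ hya (by rw [h, zero_div])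
          rw [← hab, inv_div, div_mul_cancel₀ _ hy0]
        · rintro ⟨x, ⟨a, b⟩, y⟩ hz ⟨x', ⟨a', b'⟩, y'⟩ hz' h
          simp only [Finset.coe_sigma, Set.mem_sigma_iff, Finset.mem_coe, Finset.mem_filter,
            Finset.mem_product] at hz hz'
          obtain ⟨-, ⟨-, hab⟩, -⟩ := hz
          obtain ⟨-, ⟨-, hab'⟩, -⟩ := hz'
          simp only [Sigma.mk.injEq, Prod.mk.injEq, heq_eq_eq] at h
          obtain ⟨⟨-, rfl⟩, rfl, rfl⟩ := h
          obtain rfl : a = a' := by linarith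
          rfl
    _ = _ := Finset.card_sigma _ _

/-- A set of nonzero reals of large multiplicative energy has a large subset of small additive
energy. -/
theorem exists_subset_addEnergy_le {A : Finset ℝ} (hA : 0 ∉ A) {N : ℕ} (hN : A.card ≤ N)
    (hne : A.Nonempty) :
    ∃ B ⊆ A, B.Nonempty ∧ B.addEnergy B ^ 2 * A.mulEnergy A ^ 3 ≤
      2 ^ 14 * 34 ^ 3 * (Nat.log 2 N + 1) ^ 9 * N ^ 6 * B.card ^ 8 := by
  have h0 : ∀ a ∈ A, a ≠ 0 := fun a ha h => hA (h ▸ ha)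
  have hH0 : 0 < A.mulEnergy A := Finset.mulEnergy_self_pos hne
  obtain ⟨Δ, hΔ0, hΔ⟩ := exists_dyadic_level (A * A) (mulRep A A)
    (fun x _ => (mulRep_le_card hA A x).trans hN) two_ne_zero
  rw [← mulEnergy_eq_sum_mulRep] at hΔ
  set P := (A * A).filter fun x => Δ ≤ mulRep A A x with hP
  obtain ⟨q, hq0, hq⟩ := exists_dyadic_level A (quotCount A P)
    (fun a ha => (quotCount_le_card A P (h0 a ha)).trans hN) one_ne_zero
  simp only [pow_one] at hq
  rw [sum_quotCount hA] at hq
  set B := A.filter fun a => q ≤ quotCount A P a with hB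
  have hBA : B ⊆ A := Finset.filter_subset _ _
  have hBN : B.card ≤ N := (Finset.card_le_card hBA).trans hN
  obtain ⟨τ, hτ0, hτ⟩ := exists_dyadic_level (B + B) (addRep B B)
    (fun x _ => (addRep_le_card B B x).trans hBN) two_ne_zero
  rw [← addEnergy_eq_sum_addRep] at hτ
  set X := (B + B).filter fun x => τ ≤ addRep B B x with hX
  have hPΔ : P.card * Δ ≤ ∑ x ∈ P, mulRep A A x :=
    Finset.card_nsmul_le_sum _ _ _ fun x hx => (Finset.mem_filter.1 hx).2
  have hPΔN : P.card * Δ ≤ N * N :=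
    hPΔ.trans ((sum_mulRep_le A A P).trans (Nat.mul_le_mul hN hN))
  have hXτ : X.card * τ ≤ B.card * B.card :=
    (Finset.card_nsmul_le_sum _ _ _ fun x hx => (Finset.mem_filter.1 hx).2).trans
      (sum_addRep_le B B X)
  have hPne : P.Nonempty := by
    rw [← Finset.card_pos]
    by_contra! h
    rw [Nat.le_zero.1 h] at hΔ
    omega
  have hΔN : Δ ≤ N := by
    obtain ⟨x, hx⟩ := hPne
    exact (Finset.mem_filter.1 hx).2.trans ((mulRep_le_card hA A x).trans hN)
  have hBne : B.Nonempty := by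
    rw [← Finset.card_pos]
    by_contra! h
    rw [Nat.le_zero.1 h] at hq
    have := Nat.mul_pos hPne.card_pos hΔ0
    omega
  have hqP : q ≤ P.card := by
    obtain ⟨a, ha⟩ := hBne
    exact (Finset.mem_filter.1 ha).2.trans (Finset.card_filter_le _ _)
  have hqN : q ≤ N := by
    obtain ⟨a, ha⟩ := hBne
    obtain ⟨ha, hqa⟩ := Finset.mem_filter.1 ha
    exact hqa.trans ((quotCount_le_card A P (h0 a ha)).trans hN)
  have hXτB : X.card * τ ^ 2 ≤ X.card * τ * B.card := by
    rcases X.eq_empty_or_nonempty with h | ⟨x, hx⟩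
    · simp [h]
    · have := (Finset.mem_filter.1 hx).2.trans (addRep_le_card B B x)
      rw [sq, ← mul_assoc]
      exact Nat.mul_le_mul_left _ this
  have hinc := card_mul_le_sum_pointsOn (P := P) (X := X) (q := q) (τ := τ) hA
    (fun a ha => (Finset.mem_filter.1 ha).2) fun x hx => (Finset.mem_filter.1 hx).2
  have hcardΛ : ((A ×ˢ B).image fun u : ℝ × ℝ => (u.1⁻¹, u.2)).card ≤ N * B.card := by
    refine Finset.card_image_le.trans ?_
    rw [Finset.card_product]
    exact Nat.mul_le_mul_right _ hN
  have hST := incidence_bound_of_product P X ((A ×ˢ B).image fun u : ℝ × ℝ => (u.1⁻¹, u.2)) (by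
    intro ℓ hℓ
    obtain ⟨u, hu, rfl⟩ := Finset.mem_image.1 hℓ
    exact inv_ne_zero (h0 _ (Finset.mem_product.1 hu).1))
  -- In the main case `x ^ 2` cancels from the cubed incidence bound, and multiplying by `x * τ ≤ b
  -- * b` produces the square of `x * τ ^ 2`, which is essentially the additive energy. The
  -- degenerate case uses `τ ≤ b` and `q ≤ p`.
  have hkey : (X.card * τ ^ 2) ^ 2 * q ^ 3 ≤ 34 ^ 3 * (P.card ^ 2 * N ^ 2 * B.card ^ 4) := by
    generalize ((A ×ˢ B).image fun u : ℝ × ℝ => (u.1⁻¹, u.2)).card = l at *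
    generalize (∑ ℓ ∈ (A ×ˢ B).image fun u : ℝ × ℝ => (u.1⁻¹, u.2),
      (pointsOn (P ×ˢ X) ℓ).card) = I at *
    generalize X.card = x at *
    generalize P.card = p at *
    generalize B.card = b at *
    rcases Nat.eq_zero_or_pos x with rfl | hx0
    · simp
    rcases hST with hST | hST
    · have h1 : x ^ 2 * (x * τ ^ 3 * q ^ 3) ≤ x ^ 2 * (34 ^ 3 * (p * N * b) ^ 2) := by
        calc x ^ 2 * (x * τ ^ 3 * q ^ 3) = (x * τ * q) ^ 3 := by ring
          _ ≤ I ^ 3 := by gcongr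
          _ ≤ 34 ^ 3 * (p * x * l) ^ 2 := hST
          _ ≤ 34 ^ 3 * (p * x * (N * b)) ^ 2 := by gcongr
          _ = _ := by ring
      have h2 := Nat.le_of_mul_le_mul_left h1 (pow_pos hx0 2)
      calc (x * τ ^ 2) ^ 2 * q ^ 3 = (x * τ ^ 3 * q ^ 3) * (x * τ) := by ring
        _ ≤ (34 ^ 3 * (p * N * b) ^ 2) * (b * b) := by gcongr
        _ = _ := by ring
    · have h1 : x * τ ^ 2 * q ≤ 34 * (N * b) * b := by
        calc x * τ ^ 2 * q ≤ x * τ * b * q := by gcongr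
          _ = x * τ * q * b := by ring
          _ ≤ 34 * l * b := Nat.mul_le_mul_right _ (hinc.trans hST)
          _ ≤ _ := by gcongr
      have hp : 1 ≤ p := hq0.trans_le hqP
      calc (x * τ ^ 2) ^ 2 * q ^ 3 = (x * τ ^ 2 * q) ^ 2 * q := by ring
        _ ≤ (34 * (N * b) * b) ^ 2 * p := by gcongr
        _ = 34 ^ 2 * (p ^ 1 * N ^ 2 * b ^ 4) := by ring
        _ ≤ 34 ^ 3 * (p ^ 2 * N ^ 2 * b ^ 4) := by gcongr <;> norm_num
  refine ⟨B, hBA, hBne, ?_⟩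
  have hp0 := hPne.card_pos
  replace hq := hPΔ.trans hq
  clear hinc hST hcardΛ hXτB hXτ hPΔ
  generalize A.mulEnergy A = H at *
  generalize B.addEnergy B = E at *
  generalize X.card = x at *
  generalize P.card = p at *
  generalize B.card = b at *
  generalize Nat.log 2 N + 1 = L at *
  have e1 : E ^ 2 * q ^ 3 ≤ 2 ^ 4 * 34 ^ 3 * L ^ 2 * p ^ 2 * N ^ 2 * b ^ 4 := by
    calc E ^ 2 * q ^ 3 ≤ (L * ((2 * τ) ^ 2 * x)) ^ 2 * q ^ 3 := by gcongr
      _ = 2 ^ 4 * L ^ 2 * ((x * τ ^ 2) ^ 2 * q ^ 3) := by ring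
      _ ≤ 2 ^ 4 * L ^ 2 * (34 ^ 3 * (p ^ 2 * N ^ 2 * b ^ 4)) := by gcongr
      _ = _ := by ring
  have e2 : p ^ 2 * (E ^ 2 * (p * Δ ^ 3)) ≤
      p ^ 2 * (2 ^ 7 * 34 ^ 3 * L ^ 5 * N ^ 2 * b ^ 7) := by
    calc p ^ 2 * (E ^ 2 * (p * Δ ^ 3)) = E ^ 2 * (p * Δ) ^ 3 := by ring
      _ ≤ E ^ 2 * (L * (2 * q * b)) ^ 3 := by gcongr
      _ = E ^ 2 * q ^ 3 * (2 ^ 3 * L ^ 3 * b ^ 3) := by ring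
      _ ≤ 2 ^ 4 * 34 ^ 3 * L ^ 2 * p ^ 2 * N ^ 2 * b ^ 4 * (2 ^ 3 * L ^ 3 * b ^ 3) := by gcongr
      _ = _ := by ring
  have e3 := Nat.le_of_mul_le_mul_left e2 (pow_pos hp0 2)
  have e4 : H ≤ 4 * L * Δ * N ^ 2 := by
    calc H ≤ L * ((2 * Δ) ^ 2 * p) := hΔ
      _ = 4 * L * Δ * (p * Δ) := by ring
      _ ≤ 4 * L * Δ * (N * N) := by gcongr
      _ = _ := by ring
  have e5 : H ≤ 8 * L ^ 2 * N ^ 2 * b := by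
    calc H ≤ L * ((2 * Δ) ^ 2 * p) := hΔ
      _ = 4 * L * Δ * (p * Δ) := by ring
      _ ≤ 4 * L * N * (L * (2 * N * b)) :=
          Nat.mul_le_mul (by gcongr) (hq.trans (by gcongr))
      _ = _ := by ring
  -- The three factors `H` get three different bounds, so that exactly `p * Δ ^ 3` appears for `e3`.
  calc E ^ 2 * H ^ 3 = E ^ 2 * (H * H * H) := by ring
    _ ≤ E ^ 2 * ((L * ((2 * Δ) ^ 2 * p)) * (4 * L * Δ * N ^ 2) * (8 * L ^ 2 * N ^ 2 * b)) := by
        gcongr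
    _ = 2 ^ 7 * (E ^ 2 * (p * Δ ^ 3)) * (L ^ 4 * N ^ 4 * b) := by ring
    _ ≤ 2 ^ 7 * (2 ^ 7 * 34 ^ 3 * L ^ 5 * N ^ 2 * b ^ 7) * (L ^ 4 * N ^ 4 * b) := by gcongr
    _ = _ := by ring

/-! ### Subadditivity of the fourth root of the additive energy. -/

lemma addEnergy_eq_sum_addRep_of_subset {A B S : Finset ℝ} (h : A + B ⊆ S) :
    A.addEnergy B = ∑ x ∈ S, addRep A B x ^ 2 := by
  rw [addEnergy_eq_sum_addRep]
  refine Finset.sum_subset h fun x _ hx => ?_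
  rw [sq_eq_zero_iff, addRep, Finset.card_eq_zero, Finset.filter_eq_empty_iff]
  intro u hu hux
  obtain ⟨h1, h2⟩ := Finset.mem_product.1 hu
  exact hx (hux ▸ Finset.add_mem_add h1 h2)

/-- The number of representations of `d` as a difference of elements of `A`. -/
noncomputable def subRep (A : Finset ℝ) (d : ℝ) : ℕ :=
  ((A ×ˢ A).filter fun u => u.1 - u.2 = d).card

lemma addEnergy_eq_sum_subRep {A B S : Finset ℝ} (hA : ∀ a ∈ A, ∀ a' ∈ A, a - a' ∈ S) :
    A.addEnergy B = ∑ d ∈ S, subRep A d * subRep B d := by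
  unfold Finset.addEnergy subRep
  rw [Finset.card_eq_sum_card_fiberwise (f := fun u => u.1.1 - u.1.2) (t := S)]
  · refine Finset.sum_congr rfl fun d _ => ?_
    rw [← Finset.card_product]
    refine Finset.card_bij' (fun u _ => (u.1, (u.2.2, u.2.1))) (fun u _ => (u.1, (u.2.2, u.2.1)))
      ?_ ?_ ?_ ?_
    · intro u hu
      simp only [Finset.mem_filter, Finset.mem_product] at hu ⊢
      obtain ⟨⟨⟨⟨h1, h2⟩, h3, h4⟩, h5⟩, h6⟩ := hu
      exact ⟨⟨⟨h1, h2⟩, h6⟩, ⟨h4, h3⟩, by linarith⟩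
    · intro u hu
      simp only [Finset.mem_filter, Finset.mem_product] at hu ⊢
      obtain ⟨⟨⟨h1, h2⟩, h6⟩, ⟨h4, h3⟩, h5⟩ := hu
      exact ⟨⟨⟨⟨h1, h2⟩, h3, h4⟩, by linarith⟩, h6⟩
    · intro u _
      rfl
    · intro u _
      rfl
  · intro u hu
    have := (Finset.mem_product.1 (Finset.mem_filter.1 hu).1).1
    exact hA _ (Finset.mem_product.1 this).1 _ (Finset.mem_product.1 this).2

/-- Cauchy–Schwarz, once the energy is written as a correlation of difference counts. -/
lemma addEnergy_sq_le (A B : Finset ℝ) :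
    A.addEnergy B ^ 2 ≤ A.addEnergy A * B.addEnergy B := by
  have hA : ∀ a ∈ A, ∀ a' ∈ A, a - a' ∈ (A - A) ∪ (B - B) := fun a ha a' ha' =>
    Finset.mem_union_left _ (Finset.sub_mem_sub ha ha')
  have hB : ∀ a ∈ B, ∀ a' ∈ B, a - a' ∈ (A - A) ∪ (B - B) := fun a ha a' ha' =>
    Finset.mem_union_right _ (Finset.sub_mem_sub ha ha')
  rw [addEnergy_eq_sum_subRep hA, addEnergy_eq_sum_subRep hA, addEnergy_eq_sum_subRep hB]
  simp only [← sq]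
  exact Finset.sum_mul_sq_le_sq_mul_sq _ _ _

lemma addRep_comm (A B : Finset ℝ) (x : ℝ) : addRep A B x = addRep B A x := by
  refine Finset.card_bij' (fun u _ => u.swap) (fun u _ => u.swap) ?_ ?_ ?_ ?_ <;>
    simp +contextual [add_comm]

lemma addRep_union_le (A B : Finset ℝ) (x : ℝ) :
    addRep (A ∪ B) (A ∪ B) x ≤ addRep A A x + 2 * addRep A B x + addRep B B x := by
  have h : ((A ∪ B) ×ˢ (A ∪ B)).filter (fun u => u.1 + u.2 = x) ⊆
      ((A ×ˢ A).filter (fun u => u.1 + u.2 = x) ∪ (A ×ˢ B).filter (fun u => u.1 + u.2 = x)) ∪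
      ((B ×ˢ A).filter (fun u => u.1 + u.2 = x) ∪ (B ×ˢ B).filter (fun u => u.1 + u.2 = x)) := by
    intro u
    simp only [Finset.mem_filter, Finset.mem_product, Finset.mem_union]
    tauto
  have h1 : addRep (A ∪ B) (A ∪ B) x ≤
      addRep A A x + addRep A B x + (addRep B A x + addRep B B x) :=
    (Finset.card_le_card h).trans <| (Finset.card_union_le _ _).trans <|
      add_le_add (Finset.card_union_le _ _) (Finset.card_union_le _ _)
  rw [addRep_comm B A] at h1
  omega

/-- The fourth root of the additive energy is subadditive. -/
lemma addEnergy_union_le {A B : Finset ℝ} {a b : ℝ} (ha : 0 ≤ a) (hb : 0 ≤ b)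
    (hA : (A.addEnergy A : ℝ) ≤ a ^ 4) (hB : (B.addEnergy B : ℝ) ≤ b ^ 4) :
    ((A ∪ B).addEnergy (A ∪ B) : ℝ) ≤ (a + b) ^ 4 := by
  set S := (A ∪ B) + (A ∪ B) with hS
  have hAB : (A.addEnergy B : ℝ) ≤ (a * b) ^ 2 := by
    refine le_of_sq_le_sq ?_ (by positivity)
    calc (A.addEnergy B : ℝ) ^ 2 ≤ A.addEnergy A * B.addEnergy B := by
          exact_mod_cast addEnergy_sq_le A B
      _ ≤ a ^ 4 * b ^ 4 := by gcongr
      _ = _ := by ring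
  have hAS : A ⊆ A ∪ B := Finset.subset_union_left
  have hBS : B ⊆ A ∪ B := Finset.subset_union_right
  rw [addEnergy_eq_sum_addRep_of_subset (Finset.add_subset_add hAS hAS)] at hA
  rw [addEnergy_eq_sum_addRep_of_subset (Finset.add_subset_add hBS hBS)] at hB
  rw [addEnergy_eq_sum_addRep_of_subset (Finset.add_subset_add hAS hBS)] at hAB
  rw [addEnergy_eq_sum_addRep]
  rw [← hS] at *
  push_cast at *
  have cs : ∀ (f g : ℝ → ℝ) (u v : ℝ), 0 ≤ u → 0 ≤ v → ∑ x ∈ S, f x ^ 2 ≤ u ^ 2 →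
      ∑ x ∈ S, g x ^ 2 ≤ v ^ 2 → ∑ x ∈ S, f x * g x ≤ u * v := by
    intro f g u v hu hv hf hg
    refine le_of_sq_le_sq ?_ (mul_nonneg hu hv)
    calc _ ≤ (∑ x ∈ S, f x ^ 2) * ∑ x ∈ S, g x ^ 2 := Finset.sum_mul_sq_le_sq_mul_sq _ _ _
      _ ≤ u ^ 2 * v ^ 2 := mul_le_mul hf hg (Finset.sum_nonneg fun _ _ => sq_nonneg _) (sq_nonneg u)
      _ = _ := by ring
  have hA' : ∑ x ∈ S, (addRep A A x : ℝ) ^ 2 ≤ (a ^ 2) ^ 2 := hA.trans (by ring_nf; rfl)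
  have hB' : ∑ x ∈ S, (addRep B B x : ℝ) ^ 2 ≤ (b ^ 2) ^ 2 := hB.trans (by ring_nf; rfl)
  have c1 := cs (fun x => addRep A A x) (fun x => addRep A B x) _ _ (sq_nonneg a)
    (mul_nonneg ha hb) hA' hAB
  have c2 := cs (fun x => addRep A A x) (fun x => addRep B B x) _ _ (sq_nonneg a)
    (sq_nonneg b) hA' hB'
  have c3 := cs (fun x => addRep A B x) (fun x => addRep B B x) _ _
    (mul_nonneg ha hb) (sq_nonneg b) hAB hB'
  calc ∑ x ∈ S, (addRep (A ∪ B) (A ∪ B) x : ℝ) ^ 2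
      ≤ ∑ x ∈ S, ((addRep A A x : ℝ) + 2 * addRep A B x + addRep B B x) ^ 2 := by
        refine Finset.sum_le_sum fun x _ => ?_
        gcongr
        exact_mod_cast addRep_union_le A B x
    _ = ∑ x ∈ S, (addRep A A x : ℝ) ^ 2 + 4 * ∑ x ∈ S, (addRep A B x : ℝ) ^ 2 +
        ∑ x ∈ S, (addRep B B x : ℝ) ^ 2 + 4 * ∑ x ∈ S, (addRep A A x : ℝ) * addRep A B x +
        2 * ∑ x ∈ S, (addRep A A x : ℝ) * addRep B B x +
        4 * ∑ x ∈ S, (addRep A B x : ℝ) * addRep B B x := by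
        simp only [Finset.mul_sum, ← Finset.sum_add_distrib]
        refine Finset.sum_congr rfl fun x _ => ?_
        ring
    -- The six sums are bounded by `a⁴, a²b², b⁴, a³b, a²b², ab³`; with weights `1, 4, 1, 4, 2, 4`
    -- this is the binomial expansion.
    _ ≤ (a + b) ^ 4 := by nlinarith

/-! ### Extremal decomposition and choice of parameters. -/

/-- If every subset of `A` of multiplicative energy above `H` contains a nonempty set of small additive
energy, then `A` splits into a part of small additive energy and a part of multiplicative energy at
most `H`. -/
lemma exists_subset_addEnergy_le_mulEnergy_sdiff_le {A : Finset ℝ} {κ H : ℝ}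
    (hκ : 0 ≤ κ) (h : ∀ A' ⊆ A, A'.Nonempty → H < A'.mulEnergy A' →
      ∃ B ⊆ A', B.Nonempty ∧ (B.addEnergy B : ℝ) ≤ (κ * B.card) ^ 4) (hH : 0 ≤ H) :
    ∃ B ⊆ A, (B.addEnergy B : ℝ) ≤ (κ * B.card) ^ 4 ∧
      ((A \ B).mulEnergy (A \ B) : ℝ) ≤ H := by
  obtain ⟨B, hB, hmax⟩ := (A.powerset.filter
    fun B => (B.addEnergy B : ℝ) ≤ (κ * B.card) ^ 4).exists_max_image Finset.card
      ⟨∅, by simp⟩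
  obtain ⟨hBA, hBE⟩ := Finset.mem_filter.1 hB
  rw [Finset.mem_powerset] at hBA
  refine ⟨B, hBA, hBE, ?_⟩
  by_contra! hcon
  have hne : (A \ B).Nonempty := by
    rw [Finset.nonempty_iff_ne_empty]
    intro h'
    rw [h'] at hcon
    simp at hcon
    linarith
  obtain ⟨D, hD, hDne, hDE⟩ := h _ Finset.sdiff_subset hne hcon
  have hdisj : Disjoint B D := Finset.disjoint_of_subset_right hD Finset.disjoint_sdiff
  have hunion := addEnergy_union_le (by positivity) (by positivity) hBE hDE
  have := hmax (B ∪ D) (Finset.mem_filter.2 ⟨Finset.mem_powerset.2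
    (Finset.union_subset hBA (hD.trans Finset.sdiff_subset)), by
      rw [Finset.card_union_of_disjoint hdisj]
      push_cast
      rwa [mul_add]⟩)
  rw [Finset.card_union_of_disjoint hdisj] at this
  have := hDne.card_pos
  omega

lemma natLog_two_add_one_le {N : ℕ} (hN : 2 ≤ N) :
    (Nat.log 2 N : ℝ) + 1 ≤ 3 * Real.log N := by
  have h2 := Real.log_two_gt_d9
  have h1 : (Nat.log 2 N : ℝ) * Real.log 2 ≤ Real.log N := by
    rw [← Real.log_pow]
    refine Real.log_le_log (by positivity) ?_
    exact_mod_cast Nat.pow_log_le_self 2 (by omega)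
  have h3 : Real.log 2 ≤ Real.log N := Real.log_le_log (by norm_num) (by exact_mod_cast hN)
  have h4 : (0 : ℝ) ≤ Nat.log 2 N := Nat.cast_nonneg _
  nlinarith

end

theorem theorem7 :
    ∃ K c : ℝ, 0 < K ∧ 0 < c ∧
      ∀ A : Finset ℝ, 2 ≤ A.card →
        ∃ B C : Finset ℝ, Disjoint B C ∧ A = B ∪ C ∧
          max (Finset.addEnergy B B : ℝ) (Finset.mulEnergy C C : ℝ) ≤
            K * (A.card : ℝ) ^ (3 - 1 / 5 : ℝ) * Real.log (A.card : ℝ) ^ c := by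
  refine ⟨16 * 2 ^ 15 * 3 ^ 5, 5, by norm_num, by norm_num, fun A hA2 => ?_⟩
  set N := A.card with hN
  have hN0 : (0 : ℝ) < N := by exact_mod_cast (by omega : 0 < N)
  have hN1 : (1 : ℝ) ≤ N := by exact_mod_cast (by omega : 1 ≤ N)
  set H : ℝ := (N : ℝ) ^ (3 - 1 / 5 : ℝ) with hHdef
  have hH1 : 1 ≤ H := Real.one_le_rpow hN1 (by norm_num)
  -- This identity fixes the exponent: it turns `N⁶ / H³` into `H² / N⁸`, so `E⁺(B) ≲ H (|B| / N)⁴`.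
  have hH5 : H ^ 5 = (N : ℝ) ^ 14 := by
    rw [hHdef, ← Real.rpow_natCast, ← Real.rpow_mul hN0.le, ← Real.rpow_natCast]
    norm_num
  set L : ℝ := (Nat.log 2 N : ℝ) + 1 with hL
  have hL1 : 1 ≤ L := by rw [hL]; linarith [Nat.cast_nonneg (α := ℝ) (Nat.log 2 N)]
  have hLlog : L ≤ 3 * Real.log N := natLog_two_add_one_le hA2
  set T : ℝ := 2 ^ 15 * L ^ 5 * H with hT
  have hT1 : 1 ≤ T := by
    have : 1 ≤ L ^ 5 := one_le_pow₀ hL1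
    rw [hT]
    nlinarith [mul_le_mul this hH1 zero_le_one (by positivity)]
  obtain ⟨t, ht1, ht⟩ : ∃ t : ℝ, 1 ≤ t ∧ t ^ 4 = T := by
    refine ⟨T ^ (1 / 4 : ℝ), Real.one_le_rpow hT1 (by norm_num), ?_⟩
    rw [← Real.rpow_natCast, ← Real.rpow_mul (by linarith)]
    norm_num
  -- Zero is set aside because it has no quotients; it later joins the additive part, at the cost of
  -- the factor 16 in `(t + 1) ^ 4 ≤ (2 * t) ^ 4`.
  have hA0 : (0 : ℝ) ∉ A.erase 0 := Finset.notMem_erase _ _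
  obtain ⟨B, hBA, hBE, hCE⟩ := exists_subset_addEnergy_le_mulEnergy_sdiff_le
    (A := A.erase 0) (κ := t / N) (H := H) (by positivity) (by
      intro A' hA' hne hlt
      have hcard : A'.card ≤ N := Finset.card_le_card (hA'.trans (Finset.erase_subset _ _))
      obtain ⟨B, hB, hBne, hE⟩ := exists_subset_addEnergy_le (fun h => hA0 (hA' h)) hcard hne
      refine ⟨B, hB, hBne, ?_⟩
      have hE' : (B.addEnergy B : ℝ) ^ 2 * (A'.mulEnergy A' : ℝ) ^ 3 ≤
          2 ^ 14 * 34 ^ 3 * L ^ 9 * (N : ℝ) ^ 6 * (B.card : ℝ) ^ 8 := by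
        rw [hL]; exact_mod_cast hE
      generalize (B.addEnergy B : ℝ) = E at *
      rw [mul_comm, mul_div_assoc', div_pow, le_div_iff₀ (by positivity), mul_pow, ht]
      refine le_of_sq_le_sq ?_ (by positivity)
      refine le_of_mul_le_mul_right ?_ (show 0 < H ^ 3 by positivity)
      calc (E * (N : ℝ) ^ 4) ^ 2 * H ^ 3 = E ^ 2 * H ^ 3 * (N : ℝ) ^ 8 := by ring
        _ ≤ E ^ 2 * (A'.mulEnergy A' : ℝ) ^ 3 * (N : ℝ) ^ 8 := by gcongr
        _ ≤ 2 ^ 14 * 34 ^ 3 * L ^ 9 * (N : ℝ) ^ 6 * (B.card : ℝ) ^ 8 * (N : ℝ) ^ 8 := by gcongr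
        _ = 2 ^ 14 * 34 ^ 3 * L ^ 9 * (B.card : ℝ) ^ 8 * H ^ 5 := by rw [hH5]; ring
        -- Rounding `34 ^ 3` up to `2 ^ 16` and `L ^ 9` to `L ^ 10` gives `T ^ 2` times `H ^ 3`.
        _ ≤ 2 ^ 30 * L ^ 10 * (B.card : ℝ) ^ 8 * H ^ 5 := by
            gcongr <;> norm_num
        _ = _ := by rw [hT]; ring) (by positivity)
  have hfin : 16 * T ≤ 16 * 2 ^ 15 * 3 ^ 5 * H * Real.log N ^ (5 : ℝ) := by
    have h5 : Real.log N ^ (5 : ℝ) = Real.log N ^ 5 := by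
      rw [← Real.rpow_natCast]; norm_num
    rw [h5, hT]
    calc 16 * (2 ^ 15 * L ^ 5 * H) ≤ 16 * (2 ^ 15 * (3 * Real.log N) ^ 5 * H) := by gcongr
      _ = _ := by ring
  have hHT : H ≤ 16 * T := by
    have : 1 ≤ L ^ 5 := one_le_pow₀ hL1
    rw [hT]
    nlinarith
  have hBt : (B.addEnergy B : ℝ) ≤ t ^ 4 := by
    refine hBE.trans ?_
    gcongr
    have : (B.card : ℝ) ≤ N := by
      exact_mod_cast Finset.card_le_card (hBA.trans (Finset.erase_subset _ _))
    rw [div_mul_eq_mul_div, div_le_iff₀ hN0]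
    gcongr
  have h0E : (({0} : Finset ℝ).addEnergy {0} : ℝ) ≤ 1 ^ 4 := by
    rw [one_pow]
    exact_mod_cast (Finset.card_filter_le _ _).trans (by simp)
  have hB'E : ((B ∪ {0}).addEnergy (B ∪ {0}) : ℝ) ≤ 16 * T := by
    refine (addEnergy_union_le (by positivity) zero_le_one hBt h0E).trans ?_
    calc (t + 1) ^ 4 ≤ (t + t) ^ 4 := by gcongr
      _ = 16 * T := by rw [← ht]; ring
  refine ⟨A \ (A.erase 0 \ B), A.erase 0 \ B, Finset.sdiff_disjoint,
    (Finset.sdiff_union_of_subset (Finset.sdiff_subset.trans (Finset.erase_subset _ _))).symm,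
    max_le ?_ (hCE.trans (hHT.trans hfin))⟩
  refine le_trans ?_ (hB'E.trans hfin)
  have hsub : A \ (A.erase 0 \ B) ⊆ B ∪ {0} := by
    intro x
    simp only [Finset.mem_sdiff, Finset.mem_erase, Finset.mem_union, Finset.mem_singleton]
    tauto
  exact_mod_cast Finset.addEnergy_mono hsub hsub
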